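/- Let $n\ge 0$ and let $Y(n)$ be the Yangian of $\mathfrak{gl}_n(\mathbb C)$: the associative unital $\mathbb C$-algebra generated by $t_{ij}^{(k)}$ ($1\le i,j\le n$, $k\ge 1$) subject to $$R(u-v)\,T_1(u)\,T_2(v)=T_2(v)\,T_1(u)\,R(u-v),\qquad R(u)=1-\frac{P_{12}}{u},$$ where $P_{12}$ is the flip of $\mathbb C^n\otimes\mathbb C^n$ and $T(u)=(t_{ij}(u))$ with $t_{ij}(u)=\delta_{ij}+\sum_{k\ge1}t_{ij}^{(k)}u^{-k}$ (the relation is understood coefficientwise in $u^{-1},v^{-1}$, after clearing the denominator $u-v$). Identify $f(u)\in Y(n)[[u^{-1}]]$ with the operator of left multiplication by $f(u)$ on $Y(n)[[u^{-1}]]$, and let $\tau^{\pm1}$ be the operators $g(u)\mapsto g(u\pm1)$ on $Y(n)[[u^{-1}]]$, so that $\tau^{\pm1}f(u)=f(u\pm1)\tau^{\pm1}$. For an $n\times n$ matrix $X=(x_{ij})$ over an associative algebra $A$ put $X^{[k]}=X_1X_2\cdots X_k\in \mathrm{End}(\mathbb C^n)^{\otimes k}\otimes A$, where $X_s=\sum_{i,j}1\otimes\cdots\otimes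 E_{ij}\otimes\cdots\otimes1\otimes x_{ij}$ with $E_{ij}$ in the $s$-th place, and let $X^k$ be the usual matrix power. Let $A_k=\frac1{k!}\sum_{\sigma\in\mathcal S_k}\mathrm{sgn}(\sigma)\,\sigma$ and $S_k=\frac1{k!}\sum_{\sigma\in\mathcal S_k}\sigma$, acting on $(\mathbb C^n)^{\otimes k}$ by permuting the tensor factors. Define the operators $$e_k(u,\tau)=\mathrm{tr}\big(A_k\,(T(u)\tau^{-1})^{[k]}\big),\quad h_k(u,\tau)=\mathrm{tr}\big(S_k\,(T(u)\tau)^{[k]}\big),\quad p_k^{\pm}(u,\tau)=\mathrm{tr}\big((T(u)\tau^{\pm1})^{k}\big),$$ the traces being over the matrix factors; in particular $e_0(u,\tau)=h_0(u,\tau)=1$. Then for every $m\ge1$, $$\sum_{k=0}^{m-1}(-1)^{m-k-1}e_k(u,\tau)\,p^-_{m-k}(u,\tau)=m\,e_m(u,\tau),$$ $$\sum_{k=0}^{m-1}h_k(u,\tau)\,p^+_{m-k}(u,\tau)=m\,h_m(u,\tau).$$ -/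

import Mathlib

namespace YangianNewton

open PowerSeries

noncomputable section

/-! ### Matrices on tensor powers

`End(ℂⁿ)^{⊗ k} ⊗ A` is realised as matrices over `A` whose rows and columns are indexed by
multi-indices `a : Fin k → Fin n`, i.e. in the basis `e_{a 0} ⊗ ⋯ ⊗ e_{a (k-1)}` of `(ℂⁿ)^{⊗ k}`. -/

/-- `End(ℂⁿ)^{⊗ k} ⊗ A`. -/
abbrev TensorMat (n k : ℕ) (A : Type*) := Matrix (Fin k → Fin n) (Fin k → Fin n) A

/-- `X_s = ∑_{ij} 1 ⊗ ⋯ ⊗ E_{ij} ⊗ ⋯ ⊗ 1 ⊗ x_{ij}`, with `E_{ij}` in the `s`-th place. -/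
def leg {n k : ℕ} {A : Type*} [Ring A] (X : Matrix (Fin n) (Fin n) A) (s : Fin k) :
    TensorMat n k A :=
  Matrix.of fun a b => if ∀ r, r ≠ s → a r = b r then X (a s) (b s) else 0

/-- `X^{[k]} = X_1 X_2 ⋯ X_k`. -/
def tensorPow {n : ℕ} {A : Type*} [Ring A] (X : Matrix (Fin n) (Fin n) A) (k : ℕ) :
    TensorMat n k A :=
  (List.ofFn fun s : Fin k => leg X s).prod

/-- The action of a permutation on `(ℂⁿ)^{⊗ k}`:
`σ (e_{b 0} ⊗ ⋯ ⊗ e_{b (k-1)}) = e_{b (σ⁻¹ 0)} ⊗ ⋯ ⊗ e_{b (σ⁻¹ (k-1))}`. -/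
def permOp (n : ℕ) {k : ℕ} (A : Type*) [Ring A] (σ : Equiv.Perm (Fin k)) : TensorMat n k A :=
  Matrix.of fun a b => if a = b ∘ σ.symm then 1 else 0

/-- The antisymmetrizer `A_k = (1/k!) ∑_σ sgn(σ) σ`. -/
def antisymmetrizer (n k : ℕ) (A : Type*) [Ring A] [Algebra ℂ A] : TensorMat n k A :=
  ((k.factorial : ℂ)⁻¹) • ∑ σ : Equiv.Perm (Fin k),
    (((Equiv.Perm.sign σ : ℤ) : ℂ)) • permOp n A σ

/-- The symmetrizer `S_k = (1/k!) ∑_σ σ`. -/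
def symmetrizer (n k : ℕ) (A : Type*) [Ring A] [Algebra ℂ A] : TensorMat n k A :=
  ((k.factorial : ℂ)⁻¹) • ∑ σ : Equiv.Perm (Fin k), permOp n A σ

/-! ### The Yangian of `gl_n(ℂ)` -/

/-- The free algebra on the symbols `t_{ij}^{(k)}`, `k ≥ 1`; the index `(i, j, k)` stands for
`t_{ij}^{(k+1)}`. -/
abbrev Free (n : ℕ) := FreeAlgebra ℂ (Fin n × Fin n × ℕ)

/-- `t_{ij}^{(k)}` in the free algebra, with `t_{ij}^{(0)} = δ_{ij}`. -/
def freeGen (n : ℕ) (i j : Fin n) : ℕ → Free n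
  | 0 => if i = j then 1 else 0
  | k + 1 => FreeAlgebra.ι ℂ (i, j, k)

/-- `t_{ij}(u) = ∑_k t_{ij}^{(k)} u^{-k}` over the free algebra, the variable being `u⁻¹`. -/
def freeT (n : ℕ) : Matrix (Fin n) (Fin n) (Free n)⟦X⟧ :=
  Matrix.of fun i j => PowerSeries.mk (freeGen n i j)

/-- `F[[u⁻¹]][[v⁻¹]]`, `F` the free algebra: the inner variable is `u⁻¹`, the outer one `v⁻¹`. -/
abbrev Free2 (n : ℕ) := (Free n)⟦X⟧⟦X⟧

/-- `u⁻¹`. -/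
def uInv (n : ℕ) : Free2 n := C (X : (Free n)⟦X⟧)

/-- `v⁻¹`. -/
def vInv (n : ℕ) : Free2 n := X

/-- `T(u)`. -/
def freeTu (n : ℕ) : Matrix (Fin n) (Fin n) (Free2 n) :=
  (freeT n).map fun f => C f

/-- `T(v)`. -/
def freeTv (n : ℕ) : Matrix (Fin n) (Fin n) (Free2 n) :=
  (freeT n).map fun f => PowerSeries.map (C : Free n →+* (Free n)⟦X⟧) f

/-- The Yang matrix `R(u - v) = 1 - P₁₂ / (u - v)` with its denominator cleared: since
`1 / (u - v) = u⁻¹ v⁻¹ / (v⁻¹ - u⁻¹)`, this is `(v⁻¹ - u⁻¹) R(u - v)`. -/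
def yangR (n : ℕ) : TensorMat n 2 (Free2 n) :=
  (vInv n - uInv n) • (1 : TensorMat n 2 (Free2 n)) -
    (uInv n * vInv n) • permOp n (Free2 n) (Equiv.swap (0 : Fin 2) 1)

/-- `R(u - v) T₁(u) T₂(v)`, times the central factor `v⁻¹ - u⁻¹`. -/
def rttLeft (n : ℕ) : TensorMat n 2 (Free2 n) :=
  yangR n * leg (freeTu n) 0 * leg (freeTv n) 1

/-- `T₂(v) T₁(u) R(u - v)`, times the central factor `v⁻¹ - u⁻¹`. -/
def rttRight (n : ℕ) : TensorMat n 2 (Free2 n) :=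
  leg (freeTv n) 1 * leg (freeTu n) 0 * yangR n

/-- The defining relations: for each matrix entry `(a, b)`, the coefficients of `u^{-r} v^{-s}` on
both sides of the RTT relation are identified. -/
inductive RTTRel (n : ℕ) : Free n → Free n → Prop
  | rtt (a b : Fin 2 → Fin n) (r s : ℕ) :
      RTTRel n (coeff r (coeff s (rttLeft n a b))) (coeff r (coeff s (rttRight n a b)))

/-- The Yangian `Y(n)` of `gl_n(ℂ)`. -/
def Yangian (n : ℕ) : Type := RingQuot (RTTRel n)

instance (n : ℕ) : Ring (Yangian n) := inferInstanceAs (Ring (RingQuot (RTTRel n)))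

instance (n : ℕ) : Algebra ℂ (Yangian n) := inferInstanceAs (Algebra ℂ (RingQuot (RTTRel n)))

/-- The quotient map from the free algebra to `Y(n)`. -/
def toYangian (n : ℕ) : Free n →ₐ[ℂ] Yangian n := RingQuot.mkAlgHom ℂ (RTTRel n)

/-- The generating matrix `T(u)`, with entries in `Y(n)[[u⁻¹]]`. -/
def genMatrix (n : ℕ) : Matrix (Fin n) (Fin n) (Yangian n)⟦X⟧ :=
  Matrix.of fun i j => PowerSeries.mk fun k => toYangian n (freeGen n i j k)

/-! ### Shift operators and symmetric functions -/

/-- `(u + c)⁻¹ = u⁻¹ (1 + c u⁻¹)⁻¹`, expanded in `u⁻¹`. -/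
def shiftedInv (c : ℂ) : ℂ⟦X⟧ := X * (1 + C c * X)⁻¹

/-- The operator `g(u) ↦ g(u + c) = ∑_k g_k (u + c)^{-k}` on `Y(n)[[u⁻¹]]`. As `(u + c)^{-k}` is
divisible by `u^{-k}`, only the terms `k ≤ d` contribute to the coefficient of `u^{-d}`. -/
def shift (n : ℕ) (c : ℂ) : Module.End ℂ (Yangian n)⟦X⟧ where
  toFun g := PowerSeries.mk fun d =>
    ∑ k ∈ Finset.range (d + 1), coeff d (shiftedInv c ^ k) • coeff k g
  map_add' f g := by
    ext d
    simp [smul_add, Finset.sum_add_distrib]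
  map_smul' a f := by
    ext d
    simp only [coeff_mk, coeff_smul, RingHom.id_apply, Finset.smul_sum]
    exact Finset.sum_congr rfl fun k _ => smul_comm _ _ _

/-- The algebra of `ℂ`-linear operators on `Y(n)[[u⁻¹]]`. -/
abbrev Op (n : ℕ) := Module.End ℂ (Yangian n)⟦X⟧

/-- `τ : g(u) ↦ g(u + 1)`. -/
def tau (n : ℕ) : Op n := shift n 1

/-- `τ⁻¹ : g(u) ↦ g(u - 1)`. -/
def tauInv (n : ℕ) : Op n := shift n (-1)

/-- `T(u)`, each entry being identified with the operator of left multiplication by it. -/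
def opT (n : ℕ) : Matrix (Fin n) (Fin n) (Op n) :=
  (genMatrix n).map fun f => LinearMap.mulLeft ℂ f

/-- `T(u) τ`. -/
def Ttau (n : ℕ) : Matrix (Fin n) (Fin n) (Op n) := (opT n).map fun x => x * tau n

/-- `T(u) τ⁻¹`. -/
def TtauInv (n : ℕ) : Matrix (Fin n) (Fin n) (Op n) := (opT n).map fun x => x * tauInv n

/-- `e_k(u, τ) = tr (A_k (T(u) τ⁻¹)^{[k]})`. -/
def elementary (n k : ℕ) : Op n :=
  Matrix.trace (antisymmetrizer n k (Op n) * tensorPow (TtauInv n) k)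

/-- `h_k(u, τ) = tr (S_k (T(u) τ)^{[k]})`. -/
def homogeneous (n k : ℕ) : Op n :=
  Matrix.trace (symmetrizer n k (Op n) * tensorPow (Ttau n) k)

/-- `p⁺_k(u, τ) = tr ((T(u) τ)^k)`. -/
def powerSumPlus (n k : ℕ) : Op n := Matrix.trace (Ttau n ^ k)

/-- `p⁻_k(u, τ) = tr ((T(u) τ⁻¹)^k)`. -/
def powerSumMinus (n k : ℕ) : Op n := Matrix.trace (TtauInv n ^ k)

end

end YangianNewton

/-! Put `ε = (-1)^j`, with `j` odd for the first identity and even for the second. At `v = u + c`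
the Yang matrix is `1 + P/c`. For `c = ±1` it is twice a projector, which the complementary
projector on the right kills. Since `T₁(u) τ^c T₂(u) τ^c = T₁(u) T₂(u + c) τ^{2c}`, the RTT relation
gives `(1 + εP) M₁ M₂ (1 - εP) = 0`, where `M = T(u) τ^c` and `ε = c` (`isManin_Ttau`,
`isManin_TtauInv`).

Newton's identities follow from this quadratic relation alone. It makes the signed sums `signedSum`
`ε`-symmetric in their columns as well as in their rows. Split the sum over `S_{k+1}` in the
unnormalized trace of `M₁ ⋯ M_k N_{k+1}` by the position exchanged with the last one. The
permutations fixing the last position give `signedTrace j M k * N.trace`. By symmetry the other `k`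
classes contribute equally, and each is, up to `ε`, the same kind of trace with one factor fewer and
`N` replaced by `M N`. Starting from `N = M` and iterating (`IsManin.signedTraceLast_pow`) yields
the power sums one by one. -/

namespace YangianNewton

open PowerSeries

noncomputable section

/-! ### Ordered products and signed column sums -/

section Combinatorics

variable {ι A : Type*} [Ring A]

/-- The ordered product `M_{a 0, b 0} M_{a 1, b 1} ⋯ M_{a (k-1), b (k-1)}`. -/
def ordProd (M : Matrix ι ι A) {k : ℕ} (a b : Fin k → ι) : A :=
  (List.ofFn fun s => M (a s) (b s)).prod

lemma ordProd_succ (M : Matrix ι ι A) {k : ℕ} (a b : Fin (k + 1) → ι) :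
    ordProd M a b =
      M (a 0) (b 0) * ordProd M (fun s : Fin k => a s.succ) (fun s => b s.succ) := by
  simp [ordProd, List.ofFn_succ]

lemma ordProd_succ_last (M : Matrix ι ι A) {k : ℕ} (a b : Fin (k + 1) → ι) :
    ordProd M a b =
      ordProd M (fun s : Fin k => a s.castSucc) (fun s => b s.castSucc) *
        M (a (Fin.last k)) (b (Fin.last k)) := by
  rw [ordProd, List.ofFn_succ', List.concat_eq_append, List.prod_append, List.prod_singleton]
  rfl

/-- The sign `(-1)^j`. -/
abbrev parity (j : ℕ) : ℤˣ := (-1) ^ j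

lemma parity_mul_self (j : ℕ) : parity j * parity j = 1 := Int.units_mul_self _

lemma parity_smul_smul (j : ℕ) (x : A) : parity j • parity j • x = x := by
  rw [smul_smul, parity_mul_self, one_smul]

/-- The relation `(1 + ε P) M₁ M₂ (1 - ε P) = 0` with `ε = (-1)^j`: for odd `j` this says that `M`
is a Manin matrix. -/
def IsManin (j : ℕ) (M : Matrix ι ι A) : Prop :=
  ∀ a b c d, M a c * M b d + parity j • (M b c * M a d) =
    parity j • (M a d * M b c + parity j • (M b d * M a c))

/-- The quadratic relation multiplied on both sides by the untouched factors. Only neighbouring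
factors can be exchanged, hence the adjacent transposition. -/
lemma IsManin.ordProd_exchange {j : ℕ} {M : Matrix ι ι A} (hM : IsManin j M) {k : ℕ} (i : Fin k)
    (a b : Fin (k + 1) → ι) :
    ordProd M a b + parity j • ordProd M (a ∘ Equiv.swap i.castSucc i.succ) b =
      parity j • (ordProd M a (b ∘ Equiv.swap i.castSucc i.succ) +
        parity j • ordProd M (a ∘ Equiv.swap i.castSucc i.succ)
          (b ∘ Equiv.swap i.castSucc i.succ)) := by
  induction k with
  | zero => exact i.elim0
  | succ k ih =>
    cases i using Fin.cases with
    | zero =>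
      have h (x : Fin k) : Equiv.swap (0 : Fin (k + 2)) 1 x.succ.succ = x.succ.succ :=
        Equiv.swap_apply_of_ne_of_ne (Fin.succ_ne_zero _)
          (fun h => Fin.succ_ne_zero x (Fin.succ_injective _ h))
      have key := congrArg (· * ordProd M (fun s : Fin k => a s.succ.succ) fun s => b s.succ.succ)
        (hM (a 0) (a 1) (b 0) (b 1))
      simp only [add_mul, smul_mul_assoc, mul_assoc] at key
      simp only [ordProd_succ, Function.comp_apply, Fin.castSucc_zero, Fin.succ_zero_eq_one,
        Equiv.swap_apply_left, Equiv.swap_apply_right, h]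
      exact key
    | succ i =>
      have h0 : Equiv.swap i.succ.castSucc i.succ.succ 0 = 0 :=
        Equiv.swap_apply_of_ne_of_ne (by simp [Fin.ext_iff]) (by simp [Fin.ext_iff])
      have hs (x : Fin (k + 1)) : Equiv.swap i.succ.castSucc i.succ.succ x.succ =
          (Equiv.swap i.castSucc i.succ x).succ := by
        rw [← Fin.succ_castSucc]
        exact (Fin.succ_injective _).swap_apply _ _ _
      have key := congrArg (M (a 0) (b 0) * ·) (ih i (fun s => a s.succ) (fun s => b s.succ))
      simp only [mul_add, mul_smul_comm] at key
      rw [ordProd_succ M a b, ordProd_succ M (a ∘ _) b, ordProd_succ M a (b ∘ _),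
        ordProd_succ M (a ∘ _) (b ∘ _)]
      simp only [Function.comp_apply, h0, hs]
      exact key

/-- `∑_σ sgn(σ)^j M_{a (σ 0), b 0} ⋯ M_{a (σ (k-1)), b (k-1)}`: a column determinant for odd `j`, a
column permanent for even `j`. -/
def signedSum (j : ℕ) (M : Matrix ι ι A) {k : ℕ} (a b : Fin k → ι) : A :=
  ∑ σ : Equiv.Perm (Fin k), Equiv.Perm.sign σ ^ j • ordProd M (a ∘ σ) b

/-- Row symmetry is mere reindexing of the sum and needs no relation on `M`. -/
lemma signedSum_comp_left (j : ℕ) (M : Matrix ι ι A) {k : ℕ} (a b : Fin k → ι)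
    (ρ : Equiv.Perm (Fin k)) :
    signedSum j M (a ∘ ρ) b = Equiv.Perm.sign ρ ^ j • signedSum j M a b := by
  rw [signedSum, signedSum, ← Equiv.sum_comp (Equiv.mulLeft ρ)
    (fun σ => Equiv.Perm.sign σ ^ j • ordProd M (a ∘ σ) b), Finset.smul_sum]
  refine Finset.sum_congr rfl fun σ _ => ?_
  rw [smul_smul, Equiv.coe_mulLeft, Equiv.Perm.sign_mul, mul_pow, ← mul_assoc,
    Int.units_mul_self, one_mul]
  rfl

/-- Column symmetry is where the quadratic relation enters. Adjacent transpositions generate the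
group, so it suffices to treat one of them. -/
lemma IsManin.signedSum_comp_right [Algebra ℂ A] {j : ℕ} {M : Matrix ι ι A} (hM : IsManin j M)
    {k : ℕ} (a b : Fin k → ι) (ρ : Equiv.Perm (Fin k)) :
    signedSum j M a (b ∘ ρ) = Equiv.Perm.sign ρ ^ j • signedSum j M a b := by
  cases k with
  | zero =>
    have : ρ = 1 := Subsingleton.elim _ _
    subst this
    simp
  | succ k =>
    have hρ : ρ ∈ Submonoid.closure
        (Set.range fun i : Fin k => Equiv.swap i.castSucc i.succ) := by
      rw [Equiv.Perm.mclosure_swap_castSucc_succ]; trivial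
    induction hρ using Submonoid.closure_induction generalizing b with
    | mem x hx =>
      obtain ⟨i, rfl⟩ := hx
      set s := Equiv.swap i.castSucc i.succ with hs
      have hsign : Equiv.Perm.sign s = -1 :=
        Equiv.Perm.sign_swap (by simp [Fin.ext_iff])
      -- Pairing `σ` with `σ * s` produces exactly the row combination in `ordProd_exchange`; the
      -- resulting factor 2 is cancelled over `ℂ`.
      have dbl (b : Fin (k + 1) → ι) : (2 : ℂ) • signedSum j M a b =
          ∑ σ : Equiv.Perm (Fin (k + 1)), Equiv.Perm.sign σ ^ j •
            (ordProd M (a ∘ σ) b + parity j • ordProd M ((a ∘ σ) ∘ s) b) := by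
        simp only [smul_add, Finset.sum_add_distrib, two_smul]
        congr 1
        rw [signedSum, ← Equiv.sum_comp (Equiv.mulRight s)]
        refine Finset.sum_congr rfl fun σ _ => ?_
        rw [Equiv.coe_mulRight, Equiv.Perm.sign_mul, hsign, mul_pow, mul_smul]
        rfl
      have h2 : (2 : ℂ) • signedSum j M a b = (2 : ℂ) • parity j • signedSum j M a (b ∘ s) := by
        rw [smul_comm (2 : ℂ), dbl, dbl, Finset.smul_sum]
        refine Finset.sum_congr rfl fun σ _ => ?_
        rw [hM.ordProd_exchange i, smul_comm]
      have h3 := smul_right_injective A (two_ne_zero : (2 : ℂ) ≠ 0) h2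
      rw [h3, hsign, parity_smul_smul]
    | one => simp
    | mul x y _ _ hx hy =>
      rw [Equiv.Perm.coe_mul, ← Function.comp_assoc, hy, hx, smul_smul, Equiv.Perm.sign_mul,
        mul_pow, mul_comm]

lemma IsManin.signedSum_comp_comp [Algebra ℂ A] {j : ℕ} {M : Matrix ι ι A} (hM : IsManin j M)
    {k : ℕ} (a b : Fin k → ι) (ρ : Equiv.Perm (Fin k)) :
    signedSum j M (a ∘ ρ) (b ∘ ρ) = signedSum j M a b := by
  rw [hM.signedSum_comp_right, signedSum_comp_left, smul_smul, Int.units_mul_self, one_smul]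

/-- The variant of `signedSum` for `k + 1` factors whose last factor, with label `none`, is taken
from a second matrix `N`. -/
def signedSumLast (j : ℕ) (M N : Matrix ι ι A) {k : ℕ} (a b : Option (Fin k) → ι) : A :=
  ∑ σ : Equiv.Perm (Option (Fin k)), Equiv.Perm.sign σ ^ j •
    (ordProd M (fun s => a (σ (some s))) (fun s => b (some s)) * N (a (σ none)) (b none))

lemma signedSumLast_self (j : ℕ) (M : Matrix ι ι A) {k : ℕ} (a b : Option (Fin k) → ι) :
    signedSumLast j M M a b =
      signedSum j M (a ∘ finSuccEquivLast) (b ∘ finSuccEquivLast) := by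
  rw [signedSum, signedSumLast, ← Equiv.sum_comp finSuccEquivLast.permCongr]
  refine Finset.sum_congr rfl fun σ _ => ?_
  rw [Equiv.Perm.sign_permCongr, ordProd_succ_last]
  simp

/-- Coset decomposition of the symmetric group over the stabilizer of `none`. A nontrivial coset
representative is the transposition of `none` and `some i`, whose sign contributes `parity j`. -/
lemma signedSumLast_eq (j : ℕ) (M N : Matrix ι ι A) {k : ℕ} (a b : Option (Fin k) → ι) :
    signedSumLast j M N a b =
      signedSum j M (a ∘ some) (b ∘ some) * N (a none) (b none) +
      ∑ i : Fin k, parity j • (signedSum j M (Function.update (a ∘ some) i (a none)) (b ∘ some) *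
        N (a (some i)) (b none)) := by
  rw [signedSumLast, ← Equiv.sum_comp Equiv.Perm.decomposeOption.symm, Fintype.sum_prod_type,
    Fintype.sum_option]
  congr 1
  · rw [signedSum, Finset.sum_mul]
    refine Finset.sum_congr rfl fun σ _ => ?_
    rw [Equiv.Perm.decomposeOption_symm_sign, smul_mul_assoc]
    simp [Function.comp_def]
  · refine Finset.sum_congr rfl fun i _ => ?_
    rw [signedSum, Finset.sum_mul, Finset.smul_sum]
    refine Finset.sum_congr rfl fun σ _ => ?_
    have h : (fun s => a (Equiv.swap none (some i) (some (σ s)))) =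
        Function.update (a ∘ some) i (a none) ∘ σ := by
      funext s
      by_cases hs : σ s = i
      · simp [hs]
      · rw [Equiv.swap_apply_of_ne_of_ne (by simp) (by simpa using hs)]
        simp [hs]
    rw [Equiv.Perm.decomposeOption_symm_apply, Equiv.Perm.sign_mul,
      Equiv.Perm.sign_swap (by simp), Equiv.optionCongr_sign, mul_pow, mul_smul, smul_mul_assoc]
    simp only [Equiv.Perm.coe_mul, Function.comp_apply, Equiv.optionCongr_apply, Option.map_some,
      Option.map_none, Equiv.swap_apply_left]
    rw [h]
    rfl

variable [Fintype ι]

/-- `k! tr(A_k M^{[k]})` for odd `j`, and `k! tr(S_k M^{[k]})` for even `j`. -/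
def signedTrace (j : ℕ) (M : Matrix ι ι A) (k : ℕ) : A :=
  ∑ b : Fin k → ι, signedSum j M b b

/-- The analogue of `signedTrace` for `M₁ ⋯ M_k N_{k+1}`. -/
def signedTraceLast (j : ℕ) (M N : Matrix ι ι A) (k : ℕ) : A :=
  ∑ b : Option (Fin k) → ι, signedSumLast j M N b b

lemma sum_option_arrow {κ B : Type*} [Fintype κ] [DecidableEq κ] [AddCommMonoid B]
    (f : (Option κ → ι) → B) :
    ∑ b, f b = ∑ b : κ → ι, ∑ c : ι, f (Equiv.piOptionEquivProd.symm (c, b)) := by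
  rw [← Equiv.sum_comp Equiv.piOptionEquivProd.symm, Fintype.sum_prod_type, Finset.sum_comm]

lemma signedTraceLast_self (j : ℕ) (M : Matrix ι ι A) (k : ℕ) :
    signedTraceLast j M M k = signedTrace j M (k + 1) := by
  simp only [signedTraceLast, signedTrace, signedSumLast_self]
  exact Equiv.sum_comp (Equiv.arrowCongr finSuccEquivLast.symm (Equiv.refl ι))
    (fun b => signedSum j M b b)

lemma signedTraceLast_eq (j : ℕ) (M N : Matrix ι ι A) (k : ℕ) :
    signedTraceLast j M N k = signedTrace j M k * N.trace +
      ∑ i : Fin k, parity j • ∑ b : Fin k → ι, ∑ c,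
        signedSum j M (Function.update b i c) b * N (b i) c := by
  rw [signedTraceLast, sum_option_arrow]
  simp only [signedSumLast_eq, Finset.sum_add_distrib]
  congr 1
  · rw [signedTrace, Matrix.trace, Finset.sum_mul_sum]
    rfl
  · simp only [Finset.smul_sum]
    rw [Finset.sum_comm]
    simp only [Finset.sum_comm (s := (Finset.univ : Finset (Fin k)))]
    rw [Finset.sum_comm]
    rfl

/-- The last `M` stands next to `N`, so summing over the column index they share forms the matrix
product without commuting any entries. -/
lemma signedTraceLast_mul (j : ℕ) (M N : Matrix ι ι A) (k : ℕ) :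
    ∑ b : Option (Fin k) → ι, ∑ c,
      signedSumLast j M M (Function.update b none c) b * N (b none) c =
    signedTraceLast j M (M * N) k := by
  rw [signedTraceLast, sum_option_arrow, sum_option_arrow]
  refine Finset.sum_congr rfl fun b _ => ?_
  rw [Finset.sum_comm]
  refine Finset.sum_congr rfl fun c _ => ?_
  have h (d : ι) : Function.update
      ((Equiv.piOptionEquivProd (β := fun _ : Option (Fin k) => ι)).symm (d, b)) none c =
      Equiv.piOptionEquivProd.symm (c, b) := by
    funext s
    cases s <;> simp [Equiv.piOptionEquivProd]
  simp only [signedSumLast, h, Finset.sum_mul]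
  rw [Finset.sum_comm]
  refine Finset.sum_congr rfl fun σ _ => ?_
  rw [Matrix.mul_apply, Finset.mul_sum, Finset.smul_sum]
  refine Finset.sum_congr rfl fun d _ => ?_
  rw [smul_mul_assoc, mul_assoc]
  rfl

/-- Simultaneous invariance in rows and columns moves position `i` to the end, next to `N`; hence
the sum does not depend on `i`. -/
lemma IsManin.sum_update [Algebra ℂ A] {j : ℕ} {M : Matrix ι ι A} (hM : IsManin j M)
    (N : Matrix ι ι A) {k : ℕ} (i : Fin (k + 1)) :
    ∑ b : Fin (k + 1) → ι, ∑ c, signedSum j M (Function.update b i c) b * N (b i) c =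
      signedTraceLast j M (M * N) k := by
  let ρ : Fin (k + 1) ≃ Option (Fin k) := (Equiv.swap i (Fin.last k)).trans finSuccEquivLast
  have hρ : ρ i = none := by simp [ρ]
  rw [← signedTraceLast_mul, ← Equiv.sum_comp (Equiv.arrowCongr ρ.symm (Equiv.refl ι))]
  refine Finset.sum_congr rfl fun b _ => Finset.sum_congr rfl fun c _ => ?_
  have hb : Equiv.arrowCongr ρ.symm (Equiv.refl ι) b = b ∘ ρ := rfl
  have hu : Function.update (b ∘ ρ) i c = Function.update b none c ∘ ρ := by
    rw [← hρ, Function.update_comp_eq_of_injective _ ρ.injective]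
  have hc (x : Option (Fin k) → ι) :
      x ∘ ρ = (x ∘ finSuccEquivLast) ∘ Equiv.swap i (Fin.last k) := rfl
  rw [hb, hu, Function.comp_apply, hρ, hc, hc, hM.signedSum_comp_comp, signedSumLast_self]

lemma IsManin.signedTraceLast_succ [Algebra ℂ A] {j : ℕ} {M : Matrix ι ι A} (hM : IsManin j M)
    (N : Matrix ι ι A) (k : ℕ) :
    signedTraceLast j M N (k + 1) = signedTrace j M (k + 1) * N.trace +
      ((k + 1 : ℕ) : ℂ) • parity j • signedTraceLast j M (M * N) k := by
  rw [signedTraceLast_eq]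
  simp only [hM.sum_update, Finset.sum_const, Finset.card_univ, Fintype.card_fin,
    Nat.cast_smul_eq_nsmul]

/-- The Newton identity for matrices satisfying `IsManin`, with a spare matrix factor `M^r`. -/
lemma IsManin.signedTraceLast_pow [DecidableEq ι] [Algebra ℂ A] {j : ℕ} {M : Matrix ι ι A}
    (hM : IsManin j M) (k r : ℕ) :
    ((k.factorial : ℂ)⁻¹) • signedTraceLast j M (M ^ r) k =
      ∑ l ∈ Finset.range (k + 1), parity j ^ (k - l) •
        (((l.factorial : ℂ)⁻¹ • signedTrace j M l) * (M ^ (k - l + r)).trace) := by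
  induction k generalizing r with
  | zero => simp [signedTraceLast_eq]
  | succ k ih =>
    have hk : ((k : ℂ) + 1) ≠ 0 := by exact_mod_cast k.succ_ne_zero
    -- The recursion turns `M ^ r` into `M ^ (r + 1)`, so the induction hypothesis is needed for
    -- every `r`.
    rw [hM.signedTraceLast_succ, Finset.sum_range_succ, add_comm (_ * _), smul_add, ← pow_succ', smul_smul,
      smul_comm _ (parity j)]
    have hfac : ((k + 1).factorial : ℂ)⁻¹ * ((k + 1 : ℕ) : ℂ) = (k.factorial : ℂ)⁻¹ := by
      rw [Nat.factorial_succ]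
      push_cast
      field_simp
    rw [hfac, ih, Finset.smul_sum]
    congr 1
    · refine Finset.sum_congr rfl fun l hl => ?_
      have hl' : l ≤ k := Nat.lt_succ_iff.mp (Finset.mem_range.mp hl)
      rw [smul_smul, ← pow_succ', Nat.succ_sub hl', show k - l + (r + 1) = (k - l).succ + r by omega]
    · simp

lemma IsManin.newton [DecidableEq ι] [Algebra ℂ A] {j : ℕ} {M : Matrix ι ι A}
    (hM : IsManin j M) {m : ℕ} (hm : 1 ≤ m) :
    ∑ k ∈ Finset.range m, parity j ^ (m - k - 1) •
        (((k.factorial : ℂ)⁻¹ • signedTrace j M k) * (M ^ (m - k)).trace) =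
      (m : ℂ) • ((m.factorial : ℂ)⁻¹ • signedTrace j M m) := by
  obtain ⟨m, rfl⟩ := Nat.exists_eq_add_of_le' hm
  have hk : ((m : ℂ) + 1) ≠ 0 := by exact_mod_cast m.succ_ne_zero
  have h := hM.signedTraceLast_pow m 1
  rw [pow_one, signedTraceLast_self] at h
  have hfac : ((m + 1 : ℕ) : ℂ) * ((m + 1).factorial : ℂ)⁻¹ = (m.factorial : ℂ)⁻¹ := by
    rw [Nat.factorial_succ]
    push_cast
    field_simp
  rw [smul_smul, hfac, h]
  refine Finset.sum_congr rfl fun l hl => ?_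
  have hl' : l ≤ m := Nat.lt_succ_iff.mp (Finset.mem_range.mp hl)
  rw [show m + 1 - l - 1 = m - l by omega, show m + 1 - l = m - l + 1 by omega]

end Combinatorics

/-! ### Matrices on tensor powers and ordered products -/

section Tensor

variable {n : ℕ} {A : Type*} [Ring A]

lemma sum_cons_arrow {ι B : Type*} [Fintype ι] [AddCommMonoid B] {k : ℕ}
    (f : (Fin (k + 1) → ι) → B) :
    ∑ b, f b = ∑ c : ι, ∑ b : Fin k → ι, f (Fin.cons c b) := by
  rw [← Equiv.sum_comp (Fin.consEquiv fun _ => ι), Fintype.sum_prod_type]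
  rfl

/-- `1 ⊗ Y` in `End(ℂⁿ)^{⊗ (k+1)} ⊗ A`. -/
def oneTensor {k : ℕ} (Y : TensorMat n k A) : TensorMat n (k + 1) A :=
  Matrix.of fun a b => if a 0 = b 0 then Y (Fin.tail a) (Fin.tail b) else 0

lemma oneTensor_one {k : ℕ} : oneTensor (1 : TensorMat n k A) = 1 := by
  ext a b
  simp only [oneTensor, Matrix.of_apply, Matrix.one_apply, ← ite_and]
  refine if_congr ⟨fun h => ?_, fun h => by simp [h]⟩ rfl rfl
  rw [← Fin.cons_self_tail a, ← Fin.cons_self_tail b, h.1, h.2]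

lemma oneTensor_mul {k : ℕ} (Y Z : TensorMat n k A) :
    oneTensor (Y * Z) = oneTensor Y * oneTensor Z := by
  ext a b
  simp only [oneTensor, Matrix.of_apply, Matrix.mul_apply, sum_cons_arrow, Fin.cons_zero,
    Fin.tail_cons, ite_mul, zero_mul, mul_ite, mul_zero]
  rw [Finset.sum_eq_single (a 0)]
  · by_cases h : a 0 = b 0 <;> simp [h]
  · intro c _ hc
    simp [hc.symm]
  · simp

lemma oneTensor_list_prod {k : ℕ} (l : List (TensorMat n k A)) :
    oneTensor l.prod = (l.map oneTensor).prod := by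
  induction l with
  | nil => simp [oneTensor_one]
  | cons Y l ih => simp [oneTensor_mul, ih]

lemma leg_succ {k : ℕ} (M : Matrix (Fin n) (Fin n) A) (s : Fin k) :
    leg M s.succ = oneTensor (leg M s) := by
  ext a b
  by_cases h : a 0 = b 0
  · simp only [leg, oneTensor, Matrix.of_apply, h, if_true, Fin.tail]
    refine if_congr ?_ rfl rfl
    rw [Fin.forall_fin_succ]
    simp [h]
  · simp [leg, oneTensor, Fin.forall_fin_succ, h, (Fin.succ_ne_zero s).symm]

lemma leg_zero_mul_oneTensor {k : ℕ} (M : Matrix (Fin n) (Fin n) A) (Y : TensorMat n k A)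
    (a b : Fin (k + 1) → Fin n) :
    (leg M 0 * oneTensor Y : TensorMat n (k + 1) A) a b = M (a 0) (b 0) * Y (Fin.tail a) (Fin.tail b) := by
  have h (c : Fin n) (d : Fin k → Fin n) :
      (∀ r : Fin (k + 1), r ≠ 0 → a r = (Fin.cons c d : Fin (k + 1) → Fin n) r) ↔
        Fin.tail a = d := by
    rw [Fin.forall_fin_succ]
    simp [funext_iff, Fin.tail]
  simp only [Matrix.mul_apply, leg, oneTensor, Matrix.of_apply, sum_cons_arrow, h, Fin.cons_zero,
    Fin.tail_cons]
  rw [Finset.sum_eq_single (b 0), Finset.sum_eq_single (Fin.tail a)]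
  · simp
  · intro d _ hd
    simp [hd.symm]
  · simp
  · intro c _ hc
    simp [hc]
  · simp

lemma tensorPow_apply (M : Matrix (Fin n) (Fin n) A) (k : ℕ) (a b : Fin k → Fin n) :
    tensorPow M k a b = ordProd M a b := by
  induction k with
  | zero => simp [tensorPow, ordProd, Subsingleton.elim a b]
  | succ k ih =>
    have h : tensorPow M (k + 1) = leg M 0 * oneTensor (tensorPow M k) := by
      rw [tensorPow, List.ofFn_succ, List.prod_cons, tensorPow, oneTensor_list_prod, List.map_ofFn]
      simp only [leg_succ]
      rfl
    rw [h, leg_zero_mul_oneTensor, ih, ordProd_succ]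
    rfl

lemma trace_permOp_mul {k : ℕ} (σ : Equiv.Perm (Fin k)) (Y : TensorMat n k A) :
    (permOp n A σ * Y).trace = ∑ b, Y (b ∘ σ) b := by
  simp only [Matrix.trace, Matrix.diag_apply, Matrix.mul_apply, permOp, Matrix.of_apply]
  refine Finset.sum_congr rfl fun a _ => ?_
  rw [Finset.sum_eq_single (a ∘ σ)]
  · simp [Function.comp_assoc]
  · intro b _ hb
    rw [if_neg, zero_mul]
    rintro rfl
    exact hb (by simp [Function.comp_assoc])
  · simp

lemma signedTrace_eq_sum_trace (j : ℕ) (M : Matrix (Fin n) (Fin n) A) (k : ℕ) :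
    signedTrace j M k =
      ∑ σ : Equiv.Perm (Fin k), Equiv.Perm.sign σ ^ j • (permOp n A σ * tensorPow M k).trace := by
  simp only [signedTrace, signedSum, trace_permOp_mul, tensorPow_apply, Finset.smul_sum]
  exact Finset.sum_comm

lemma trace_antisymmetrizer_mul [Algebra ℂ A] (M : Matrix (Fin n) (Fin n) A) (k : ℕ) :
    (antisymmetrizer n k A * tensorPow M k).trace = (k.factorial : ℂ)⁻¹ • signedTrace 1 M k := by
  rw [antisymmetrizer, smul_mul_assoc, Matrix.trace_smul, Finset.sum_mul, Matrix.trace_sum,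
    signedTrace_eq_sum_trace]
  congr 1
  refine Finset.sum_congr rfl fun σ _ => ?_
  rw [smul_mul_assoc, Matrix.trace_smul, pow_one, Int.cast_smul_eq_zsmul, Units.smul_def]

lemma trace_symmetrizer_mul [Algebra ℂ A] (M : Matrix (Fin n) (Fin n) A) (k : ℕ) :
    (symmetrizer n k A * tensorPow M k).trace = (k.factorial : ℂ)⁻¹ • signedTrace 0 M k := by
  rw [symmetrizer, smul_mul_assoc, Matrix.trace_smul, Finset.sum_mul, Matrix.trace_sum,
    signedTrace_eq_sum_trace]
  simp

end Tensor

/-! ### Substitution of a central series for the outer variable -/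

section Evaluation

variable {A : Type*} [Ring A]

lemma coeff_pow_mul_eq_zero {z : A⟦X⟧} (hz : X ∣ z) {d k : ℕ} (h : d < k) (f : A⟦X⟧) :
    coeff d (z ^ k * f) = 0 := by
  obtain ⟨w, rfl⟩ := hz
  rw [(commute_X w).symm.mul_pow, mul_assoc, coeff_X_pow_mul', if_neg (not_le.mpr h)]

/-- `F(v⁻¹) ↦ F(z)` on coefficients, for `z` divisible by the variable of `A⟦X⟧`. -/
def evalOuterFun (z : A⟦X⟧) (F : A⟦X⟧⟦X⟧) : A⟦X⟧ :=
  PowerSeries.mk fun d => coeff d (∑ k ∈ Finset.range (d + 1), z ^ k * coeff k F)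

/-- Any sufficiently long truncation gives the same coefficient, so one truncation can serve for
several series at once. -/
lemma coeff_evalOuterFun {z : A⟦X⟧} (hz : X ∣ z) (F : A⟦X⟧⟦X⟧) {d N : ℕ} (h : d < N) :
    coeff d (evalOuterFun z F) = coeff d (∑ k ∈ Finset.range N, z ^ k * coeff k F) := by
  rw [evalOuterFun, coeff_mk, map_sum, map_sum]
  refine Finset.sum_subset (Finset.range_subset_range.mpr h) fun k _ hk => ?_
  exact coeff_pow_mul_eq_zero hz (by simpa using hk) _

lemma evalOuterFun_mul {z : A⟦X⟧} (hz : X ∣ z) (hc : ∀ f, Commute z f) (F G : A⟦X⟧⟦X⟧) :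
    evalOuterFun z (F * G) = evalOuterFun z F * evalOuterFun z G := by
  ext d
  have hprod : coeff d (evalOuterFun z F * evalOuterFun z G) =
      coeff d ((∑ k ∈ Finset.range (d + 1), z ^ k * coeff k F) *
        ∑ k ∈ Finset.range (d + 1), z ^ k * coeff k G) := by
    rw [coeff_mul, coeff_mul]
    refine Finset.sum_congr rfl fun p hp => ?_
    have := Finset.HasAntidiagonal.mem_antidiagonal.mp hp
    rw [coeff_evalOuterFun hz F (show p.1 < d + 1 by omega),
      coeff_evalOuterFun hz G (show p.2 < d + 1 by omega)]
  have hterm (k l : ℕ) : z ^ k * coeff k F * (z ^ l * coeff l G) =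
      z ^ (k + l) * (coeff k F * coeff l G) := by
    rw [pow_add, mul_assoc, ← mul_assoc (coeff k F), ← ((hc (coeff k F)).pow_left l).eq]
    simp only [mul_assoc]
  rw [hprod, coeff_evalOuterFun hz _ d.lt_succ_self, Finset.sum_mul_sum]
  simp only [hterm, coeff_mul _ F G, Finset.mul_sum, map_sum]
  rw [← Finset.sum_product', Finset.sum_sigma']
  -- The triangle of pairs with `k + l ≤ d` sits inside the square; pairs outside it carry `z ^ (k +
  -- l)` with `k + l > d` and do not reach degree `d`.
  refine Finset.sum_of_injOn (fun x => x.2) ?_ ?_ ?_ ?_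
  · rintro ⟨m, p⟩ hp ⟨m', p'⟩ hp' rfl
    simp only [Finset.coe_sigma, Set.mem_sigma_iff, Finset.mem_coe,
      Finset.HasAntidiagonal.mem_antidiagonal] at hp hp'
    obtain rfl : m = m' := hp.2.symm.trans hp'.2
    rfl
  · rintro ⟨m, p⟩ hp
    simp only [Finset.coe_sigma, Set.mem_sigma_iff, Finset.mem_coe, Finset.mem_range,
      Finset.HasAntidiagonal.mem_antidiagonal, Finset.coe_product, Set.mem_prod] at hp ⊢
    omega
  · intro p _ hp
    refine coeff_pow_mul_eq_zero hz (not_le.mp fun h => hp ?_) _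
    exact ⟨⟨p.1 + p.2, p⟩, by simpa using Nat.lt_succ_iff.mpr h, rfl⟩
  · rintro ⟨m, p⟩ hp
    simp only [Finset.mem_sigma, Finset.HasAntidiagonal.mem_antidiagonal] at hp
    rw [← hp.2]

/-- Evaluation of the outer variable at a central series without constant term. -/
def evalOuter (z : A⟦X⟧) (hz : X ∣ z) (hc : ∀ f, Commute z f) : A⟦X⟧⟦X⟧ →+* A⟦X⟧ where
  toFun := evalOuterFun z
  map_zero' := by ext d; simp [evalOuterFun]
  map_add' F G := by
    ext d
    simp [evalOuterFun, mul_add, Finset.sum_add_distrib]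
  map_one' := by
    ext d
    rw [coeff_evalOuterFun hz _ d.lt_succ_self, Finset.sum_eq_single 0]
    · simp
    · intro k _ hk
      simp [coeff_one, hk]
    · simp
  map_mul' := evalOuterFun_mul hz hc

variable {z : A⟦X⟧} {hz : X ∣ z} {hc : ∀ f, Commute z f}

lemma evalOuter_C (f : A⟦X⟧) : evalOuter z hz hc (C f) = f := by
  ext d
  change coeff d (evalOuterFun z _) = _
  rw [coeff_evalOuterFun hz _ d.lt_succ_self, Finset.sum_eq_single 0]
  · simp
  · intro k _ hk
    simp [coeff_C, hk]
  · simp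

lemma evalOuter_X : evalOuter z hz hc X = z := by
  ext d
  change coeff d (evalOuterFun z _) = _
  -- Length `d + 2` keeps the term `k = 1` in range even when `d = 0`.
  rw [coeff_evalOuterFun hz _ (show d < d + 2 by omega), Finset.sum_eq_single 1]
  · simp
  · intro k _ hk
    simp [coeff_X, hk]
  · simp

end Evaluation

/-! ### The shift operators -/

section Shift

variable (n : ℕ)

/-- `(u + c)⁻¹` as a series over `Y(n)`. -/
def shiftedInvY (c : ℂ) : (Yangian n)⟦X⟧ :=
  PowerSeries.map (algebraMap ℂ (Yangian n)) (shiftedInv c)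

lemma X_dvd_shiftedInvY (c : ℂ) : X ∣ shiftedInvY n c :=
  ⟨PowerSeries.map (algebraMap ℂ (Yangian n)) (1 + C c * X)⁻¹, by simp [shiftedInvY, shiftedInv]⟩

lemma map_algebraMap_commute (s : ℂ⟦X⟧) (f : (Yangian n)⟦X⟧) :
    Commute (PowerSeries.map (algebraMap ℂ (Yangian n)) s) f := by
  ext d
  rw [coeff_mul, coeff_mul]
  refine Finset.sum_equiv (Equiv.prodComm ℕ ℕ) (by simp [add_comm]) fun p _ => ?_
  rw [coeff_map]
  exact Algebra.commutes (coeff p.1 s) (coeff p.2 f)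

lemma shiftedInvY_commute (c : ℂ) (f : (Yangian n)⟦X⟧) : Commute (shiftedInvY n c) f :=
  map_algebraMap_commute n _ f

/-- Evaluation of `v` at `u + c`. -/
def evalShift (c : ℂ) : (Yangian n)⟦X⟧⟦X⟧ →+* (Yangian n)⟦X⟧ :=
  evalOuter (shiftedInvY n c) (X_dvd_shiftedInvY n c) (shiftedInvY_commute n c)

lemma evalShift_C (c : ℂ) (f : (Yangian n)⟦X⟧) : evalShift n c (C f) = f :=
  evalOuter_C f

lemma evalShift_X (c : ℂ) : evalShift n c X = shiftedInvY n c :=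
  evalOuter_X

/-- Expresses the shift through ring homomorphisms, which makes it multiplicative. -/
lemma shift_eq_evalShift (c : ℂ) (g : (Yangian n)⟦X⟧) :
    shift n c g = evalShift n c (PowerSeries.map C g) := by
  ext d
  have h1 : shift n c g = PowerSeries.mk fun d =>
    ∑ k ∈ Finset.range (d + 1), coeff d (shiftedInv c ^ k) • coeff k g := rfl
  have h2 : evalShift n c (PowerSeries.map C g) =
    evalOuterFun (shiftedInvY n c) (PowerSeries.map C g) := rfl
  rw [h1, h2, evalOuterFun, coeff_mk, coeff_mk, map_sum]
  refine Finset.sum_congr rfl fun k _ => ?_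
  rw [coeff_map, coeff_mul_C, shiftedInvY, ← map_pow, coeff_map, Algebra.smul_def]

lemma shift_mul (c : ℂ) (f g : (Yangian n)⟦X⟧) :
    shift n c (f * g) = shift n c f * shift n c g := by
  simp only [shift_eq_evalShift, map_mul]

lemma shiftedInv_sub_X (c : ℂ) : shiftedInv c - X = -(C c * (X * shiftedInv c)) := by
  have h : (1 + C c * X) * (1 + C c * X)⁻¹ = 1 :=
    PowerSeries.mul_inv_cancel _ (by simp)
  rw [shiftedInv]
  linear_combination X * h

/-- Multiplying by `1 + c u⁻¹` turns the factor into `u⁻²`, and powers of the variable cancel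
coefficientwise. -/
lemma X_mul_shiftedInvY_cancel (c : ℂ) {f g : (Yangian n)⟦X⟧}
    (h : X * shiftedInvY n c * f = X * shiftedInvY n c * g) : f = g := by
  have hq : PowerSeries.map (algebraMap ℂ (Yangian n)) (1 + C c * X) * (X * shiftedInvY n c) =
      X ^ 2 := by
    have h1 : (1 + C c * X) * (X * shiftedInv c) = X ^ 2 := by
      rw [shiftedInv]
      linear_combination X ^ 2 * PowerSeries.mul_inv_cancel (1 + C c * X) (by simp)
    simpa only [map_mul, map_pow, map_X, shiftedInvY] using
      congrArg (PowerSeries.map (algebraMap ℂ (Yangian n))) h1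
  have h2 := congrArg (PowerSeries.map (algebraMap ℂ (Yangian n)) (1 + C c * X) * ·) h
  simp only [← mul_assoc] at h2 hq
  rw [hq] at h2
  ext d
  simpa only [coeff_X_pow_mul] using congrArg (coeff (d + 2)) h2

end Shift

/-! ### The RTT relation at `v = u + c` -/

section RTT

variable (n : ℕ)

/-- The specialization `v = u + c`, from series over the free algebra to series over `Y(n)`. -/
def specialize (c : ℂ) : Free2 n →+* (Yangian n)⟦X⟧ :=
  (evalShift n c).comp (PowerSeries.map (PowerSeries.map (toYangian n : Free n →+* Yangian n)))

lemma specialize_uInv (c : ℂ) : specialize n c (uInv n) = X := by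
  simp [specialize, uInv, evalShift_C]

lemma specialize_vInv (c : ℂ) : specialize n c (vInv n) = shiftedInvY n c := by
  simp [specialize, vInv, evalShift_X]

lemma map_freeT (i j : Fin n) :
    PowerSeries.map (toYangian n : Free n →+* Yangian n) (freeT n i j) = genMatrix n i j := by
  ext d
  simp [freeT, genMatrix]

lemma specialize_freeTu (c : ℂ) (i j : Fin n) :
    specialize n c (freeTu n i j) = genMatrix n i j := by
  simp [specialize, freeTu, evalShift_C, map_freeT]

lemma specialize_freeTv (c : ℂ) (i j : Fin n) :
    specialize n c (freeTv n i j) = shift n c (genMatrix n i j) := by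
  rw [shift_eq_evalShift, ← map_freeT, specialize, freeTv, RingHom.comp_apply]
  congr 1
  ext r s
  simp [coeff_map]

lemma specialize_rtt (c : ℂ) (a b : Fin 2 → Fin n) :
    specialize n c (rttLeft n a b) = specialize n c (rttRight n a b) := by
  rw [specialize, RingHom.comp_apply, RingHom.comp_apply]
  refine congrArg _ ?_
  ext s r
  simp only [coeff_map]
  exact RingQuot.mkAlgHom_rel ℂ (RTTRel.rtt a b r s)

lemma leg_zero_mul_leg_one {A : Type*} [Ring A] (M N : Matrix (Fin n) (Fin n) A)
    (a b : Fin 2 → Fin n) : (leg M 0 * leg N 1 : TensorMat n 2 A) a b = M (a 0) (b 0) * N (a 1) (b 1) := by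
  rw [← Fin.succ_zero_eq_one, leg_succ, leg_zero_mul_oneTensor]
  simp [leg, Fin.tail]

lemma leg_one_mul_leg_zero {A : Type*} [Ring A] (M N : Matrix (Fin n) (Fin n) A)
    (a b : Fin 2 → Fin n) : (leg N 1 * leg M 0 : TensorMat n 2 A) a b = N (a 1) (b 1) * M (a 0) (b 0) := by
  -- The left factor fixes slot 0 and the right factor fixes slot 1, leaving one intermediate index.
  rw [Matrix.mul_apply, Finset.sum_eq_single ![a 0, b 1]]
  · simp [leg, Fin.forall_fin_two]
  · intro d _ hd
    by_cases h0 : a 0 = d 0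
    · have h1 : d 1 ≠ b 1 := fun h1 => hd (by ext r; fin_cases r <;> simp [h0, h1])
      simp [leg, Fin.forall_fin_two, h1]
    · simp [leg, Fin.forall_fin_two, h0]
  · simp

lemma yangR_mul_apply (Y : TensorMat n 2 (Free2 n)) (a b : Fin 2 → Fin n) :
    (yangR n * Y) a b = (vInv n - uInv n) * Y a b -
      uInv n * vInv n * Y (a ∘ Equiv.swap 0 1) b := by
  rw [yangR, sub_mul, Matrix.sub_apply, smul_mul_assoc, smul_mul_assoc, one_mul, Matrix.smul_apply,
    Matrix.smul_apply, smul_eq_mul, smul_eq_mul, Matrix.mul_apply,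
    Finset.sum_eq_single (a ∘ Equiv.swap 0 1)]
  · simp [permOp, Function.comp_assoc, ← Equiv.coe_trans]
  · intro d _ hd
    rw [permOp, Matrix.of_apply, if_neg, zero_mul]
    rintro rfl
    exact hd (by simp [Function.comp_assoc, ← Equiv.coe_trans])
  · simp

lemma mul_yangR_apply (Y : TensorMat n 2 (Free2 n)) (a b : Fin 2 → Fin n) :
    (Y * yangR n) a b = Y a b * (vInv n - uInv n) -
      Y a (b ∘ Equiv.swap 0 1) * (uInv n * vInv n) := by
  rw [yangR, mul_sub, Matrix.sub_apply, Matrix.mul_apply, Matrix.mul_apply,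
    Finset.sum_eq_single b, Finset.sum_eq_single (b ∘ Equiv.swap 0 1)]
  · simp [permOp]
  · intro d _ hd
    simp [permOp, hd]
  · simp
  · intro d _ hd
    simp [hd]
  · simp

/-- The RTT relation at `v = u + c`, without denominators. -/
lemma rtt_shift (c : ℂ) (i k j l : Fin n) :
    c • (genMatrix n i j * shift n c (genMatrix n k l)) +
        genMatrix n k j * shift n c (genMatrix n i l) =
      c • (shift n c (genMatrix n k l) * genMatrix n i j) +
        shift n c (genMatrix n k j) * genMatrix n i l := by
  have h := specialize_rtt n c ![i, k] ![j, l]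
  rw [rttLeft, rttRight, mul_assoc, yangR_mul_apply, mul_yangR_apply] at h
  simp only [leg_zero_mul_leg_one, leg_one_mul_leg_zero, map_sub, map_mul, specialize_uInv,
    specialize_vInv, specialize_freeTu, specialize_freeTv, Function.comp_apply,
    Equiv.swap_apply_left, Equiv.swap_apply_right, Matrix.cons_val_zero, Matrix.cons_val_one] at h
  -- Thus the cleared Yang matrix becomes `-u⁻¹ (u + c)⁻¹ (c + P)`, whose scalar factor is then
  -- cancelled.
  have hz : shiftedInvY n c - X = -(c • (X * shiftedInvY n c)) := by
    have := congrArg (PowerSeries.map (algebraMap ℂ (Yangian n))) (shiftedInv_sub_X c)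
    rw [map_sub, map_X, map_neg, map_mul, map_mul, map_X] at this
    rw [shiftedInvY, this, map_C, ← smul_eq_C_mul, algebraMap_smul]
  have hXz (f : (Yangian n)⟦X⟧) : f * (X * shiftedInvY n c) = X * shiftedInvY n c * f := by
    rw [← mul_assoc, (commute_X f).eq, mul_assoc, ← (shiftedInvY_commute n c f).eq, mul_assoc]
  rw [hz, mul_neg, mul_smul_comm, hXz, hXz, neg_mul, smul_mul_assoc] at h
  refine X_mul_shiftedInvY_cancel n c ?_
  simp only [mul_add, mul_smul_comm]
  rw [← neg_inj, neg_add', neg_add']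
  exact h

end RTT

/-! ### Newton identities -/

lemma mulLeft_mul_shift_mul (n : ℕ) (c : ℂ) (f g : (Yangian n)⟦X⟧) :
    LinearMap.mulLeft ℂ f * shift n c * (LinearMap.mulLeft ℂ g * shift n c) =
      LinearMap.mulLeft ℂ (f * shift n c g) * (shift n c * shift n c) := by
  ext x : 1
  simp only [Module.End.mul_apply, LinearMap.mulLeft_apply, shift_mul, mul_assoc]

/-- At `c = 1` the right side of `rtt_shift` is symmetric in the two column indices, so the left
side is too. -/
lemma isManin_Ttau (n : ℕ) : IsManin 0 (Ttau n) := by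
  intro a b c d
  have h1 := rtt_shift n 1 a b c d
  have h2 := rtt_shift n 1 a b d c
  have h : genMatrix n a c * shift n 1 (genMatrix n b d) +
        genMatrix n b c * shift n 1 (genMatrix n a d) =
      genMatrix n a d * shift n 1 (genMatrix n b c) +
        genMatrix n b d * shift n 1 (genMatrix n a c) := by
    rw [one_smul, one_smul] at h1 h2
    rw [h1, h2, add_comm]
  ext x : 1
  simp only [Ttau, opT, tau, Matrix.map_apply, mulLeft_mul_shift_mul, parity, pow_zero, one_smul,
    LinearMap.add_apply, Module.End.mul_apply, LinearMap.mulLeft_apply, ← add_mul, h]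

/-- At `c = -1` the right side of `rtt_shift` is antisymmetric in the two column indices, so the
left side is too. -/
lemma isManin_TtauInv (n : ℕ) : IsManin 1 (TtauInv n) := by
  intro a b c d
  have h1 := rtt_shift n (-1) a b c d
  have h2 := rtt_shift n (-1) a b d c
  have h : genMatrix n a c * shift n (-1) (genMatrix n b d) -
        genMatrix n b c * shift n (-1) (genMatrix n a d) =
      -(genMatrix n a d * shift n (-1) (genMatrix n b c) -
        genMatrix n b d * shift n (-1) (genMatrix n a c)) := by
    simp only [neg_smul, one_smul, neg_add_eq_sub] at h1 h2
    rw [neg_sub, h2, ← neg_sub, h1, neg_sub]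
  ext x : 1
  simp only [TtauInv, opT, tauInv, Matrix.map_apply, mulLeft_mul_shift_mul, parity, pow_one,
    Units.neg_smul, one_smul, ← sub_eq_add_neg, LinearMap.sub_apply, LinearMap.neg_apply,
    Module.End.mul_apply, LinearMap.mulLeft_apply, ← sub_mul, h, neg_mul]

end

end YangianNewton

theorem mainTheorem1 (n m : ℕ) (hm : 1 ≤ m) :
    (∑ k ∈ Finset.range m, (-1 : ℂ) ^ (m - k - 1) •
        (YangianNewton.elementary n k * YangianNewton.powerSumMinus n (m - k)) =
      (m : ℂ) • YangianNewton.elementary n m) ∧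
    (∑ k ∈ Finset.range m,
        YangianNewton.homogeneous n k * YangianNewton.powerSumPlus n (m - k) =
      (m : ℂ) • YangianNewton.homogeneous n m) := by
  simp only [YangianNewton.elementary, YangianNewton.homogeneous, YangianNewton.powerSumMinus,
    YangianNewton.powerSumPlus, YangianNewton.trace_antisymmetrizer_mul,
    YangianNewton.trace_symmetrizer_mul]
  refine ⟨(Finset.sum_congr rfl fun k _ => ?_).trans ((YangianNewton.isManin_TtauInv n).newton hm),
    (Finset.sum_congr rfl fun k _ => ?_).trans ((YangianNewton.isManin_Ttau n).newton hm)⟩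
  · rw [YangianNewton.parity, pow_one]
    rw [Units.smul_def, ← Int.cast_smul_eq_zsmul ℂ]
    push_cast
    rfl
  · rw [YangianNewton.parity, pow_zero, one_pow, one_smul]
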